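/- Let $G$ be a finite connected simple undirected graph with vertex set $V$ and diameter $D$. Let $E$ be the set of its directed edges, that is, of ordered pairs $(i,j)$ of adjacent vertices, so that each undirected edge contributes the two elements $(i,j)$ and $(j,i)$ to $E$. For $u,v\in V$ let $H(u,v)$ be the expected value of the first time $t\ge 0$ at which simple random walk on $G$ started at $u$ is at $v$ (so $H(v,v)=0$). Then all $H(u,v)$ are finite, and the number \[ K := \max_{u,v\in V}\left( H(u,v) + \frac12\Big( \#E + \sum_{(i,j)\in E} \big|H(i,v)-H(j,v)-1\big| \Big)\right) \] satisfies \[ K \ge \frac14\, D\,\#E - 1 . \] -/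

import Mathlib

open scoped ENNReal

noncomputable section

namespace RandomWalk

/-- One step of simple random walk: a uniformly chosen neighbour of `x`. (An isolated vertex,
which in a connected graph occurs only if it is the only vertex, is absorbing.) -/
def stepLaw {V : Type*} [Fintype V] (G : SimpleGraph V) [DecidableRel G.Adj] (x : V) : PMF V :=
  if h : (G.neighborFinset x).Nonempty then PMF.uniformOfFinset (G.neighborFinset x) h
  else PMF.pure x

/-- The transition kernel of simple random walk. -/
def stepKernel {V : Type*} [Fintype V] [MeasurableSpace V] [DiscreteMeasurableSpace V]
    (G : SimpleGraph V) [DecidableRel G.Adj] : ProbabilityTheory.Kernel V V :=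
  ProbabilityTheory.Kernel.ofFunOfCountable fun x => (stepLaw G x).toMeasure

instance {V : Type*} [Fintype V] [MeasurableSpace V] [DiscreteMeasurableSpace V]
    (G : SimpleGraph V) [DecidableRel G.Adj] :
    ProbabilityTheory.IsMarkovKernel (stepKernel G) :=
  ⟨fun x => PMF.toMeasure.isProbabilityMeasure (stepLaw G x)⟩

/-- The law of the next position given the history up to time `n`; it depends only on the
position at time `n`. -/
def historyKernel {V : Type*} [Fintype V] [MeasurableSpace V] [DiscreteMeasurableSpace V]
    (G : SimpleGraph V) [DecidableRel G.Adj] (n : ℕ) :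
    ProbabilityTheory.Kernel (Finset.Iic n → V) V :=
  (stepKernel G).comap (fun h => h ⟨n, Finset.mem_Iic.2 le_rfl⟩) (measurable_pi_apply _)

instance {V : Type*} [Fintype V] [MeasurableSpace V] [DiscreteMeasurableSpace V]
    (G : SimpleGraph V) [DecidableRel G.Adj] (n : ℕ) :
    ProbabilityTheory.IsMarkovKernel (historyKernel G n) := by
  unfold historyKernel
  infer_instance

/-- The law, on the space `ℕ → V` of trajectories, of simple random walk on `G` started at `u`. -/
def walkLaw {V : Type*} [Fintype V] [MeasurableSpace V] [DiscreteMeasurableSpace V]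
    (G : SimpleGraph V) [DecidableRel G.Adj] (u : V) : MeasureTheory.Measure (ℕ → V) :=
  ProbabilityTheory.Kernel.trajMeasure (X := fun _ : ℕ => V)
    (MeasureTheory.Measure.dirac u) (historyKernel G)

/-- The first time `t ≥ 0` at which the trajectory `ω` is at `v` (`⊤` if there is none). -/
def firstHit {V : Type*} (v : V) (ω : ℕ → V) : ℕ∞ :=
  MeasureTheory.hittingAfter (fun (t : ℕ) (ω : ℕ → V) => ω t) {v} 0 ω

/-- The expected time for random walk started at `u` to hit `v`, possibly infinite. -/
def expectedHit {V : Type*} [Fintype V] [MeasurableSpace V] [DiscreteMeasurableSpace V]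
    (G : SimpleGraph V) [DecidableRel G.Adj] (u v : V) : ℝ≥0∞ :=
  ∫⁻ ω, (firstHit v ω : ℝ≥0∞) ∂(walkLaw G u)

/-- The expected hitting time `H(u, v)` as a real number. -/
def H {V : Type*} [Fintype V] [MeasurableSpace V] [DiscreteMeasurableSpace V]
    (G : SimpleGraph V) [DecidableRel G.Adj] (u v : V) : ℝ :=
  (expectedHit G u v).toReal

/-- `max_{u,v} (H(u,v) + (#E + ∑_{(i,j) ∈ E} |H(i,v) - H(j,v) - 1|) / 2)`, where `E` is the set of
directed edges (darts): each undirected edge counts as a pair of opposite directed edges. -/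
def K {V : Type*} [Fintype V] [MeasurableSpace V] [DiscreteMeasurableSpace V]
    (G : SimpleGraph V) [DecidableRel G.Adj] : ℝ :=
  ⨆ p : V × V, (H G p.1 p.2 + 1 / 2 * ((Fintype.card G.Dart : ℝ) +
    ∑ e : G.Dart, |H G e.fst p.2 - H G e.snd p.2 - 1|))

end RandomWalk

end

namespace RandomWalk

open MeasureTheory ProbabilityTheory Preorder

/-! ### Finite-time laws of the walk -/

section Law

variable {V : Type*} [Fintype V] [MeasurableSpace V] [DiscreteMeasurableSpace V]
  (G : SimpleGraph V) [DecidableRel G.Adj]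

/-! Fix `v` and put h = H(·,v), d = dist(·,v). First-step analysis gives ∑_{y∼x} (h(x) − h(y)) = deg
x for x ≠ v (`sum_H_sub_eq_degree`). Testing this against d, which vanishes at v and is 1-Lipschitz
along edges, bounds the sum in K below by 2 ∑ deg(x) d(x) (`two_mul_sum_degree_mul_dist_le`). Adding
these bounds for the two ends of a diameter and using the triangle inequality yields K ≥ D #E/2 +
#E/2, more than is claimed. Finiteness of H, which also makes the real-valued identities legitimate,
comes from a function exponential in −d (`expectedHit_ne_top`). -/

/-- The transition operator of simple random walk acting on functions. -/
noncomputable def stepMean (f : V → ℝ≥0∞) (x : V) : ℝ≥0∞ := ∫⁻ y, f y ∂(stepKernel G x)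

/-- The transition operator of the walk killed on arrival at `v`. -/
noncomputable def killedMean (v : V) (f : V → ℝ≥0∞) : V → ℝ≥0∞ :=
  stepMean G (({v}ᶜ : Set V).indicator f)

theorem lintegral_walkLaw_zero (u : V) (f : V → ℝ≥0∞) :
    ∫⁻ ω, f (ω 0) ∂(walkLaw G u) = f u := by
  have hf : Measurable f := measurable_of_finite f
  have h : walkLaw G u = Kernel.traj (X := fun _ : ℕ => V) (historyKernel G) 0
      ((MeasurableEquiv.piUnique fun _ : Finset.Iic 0 => V).symm u) := by
    unfold walkLaw Kernel.trajMeasure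
    have hm : Measurable (MeasurableEquiv.piUnique fun _ : Finset.Iic 0 => V).symm :=
      MeasurableEquiv.measurable _
    erw [Measure.map_dirac' hm]
    exact Measure.dirac_bind (Kernel.measurable _) _
  have h2 : ∫⁻ ω, f (ω 0) ∂(walkLaw G u) =
      ∫⁻ z, f (z ⟨0, Finset.mem_Iic.2 le_rfl⟩)
        ∂((walkLaw G u).map (frestrictLe (π := fun _ : ℕ => V) 0)) := by
    rw [lintegral_map (by fun_prop) (by fun_prop)]
    rfl
  rw [h2, h, Kernel.traj_map_frestrictLe_apply, Kernel.partialTraj_self, Kernel.id_apply,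
    lintegral_dirac' _ (by fun_prop)]
  rfl

theorem lintegral_walkLaw_succ (u : V) (n : ℕ) (F : (Finset.Iic n → V) → ℝ≥0∞) (f : V → ℝ≥0∞) :
    ∫⁻ ω, F (frestrictLe (π := fun _ : ℕ => V) n ω) * f (ω (n + 1)) ∂(walkLaw G u) =
      ∫⁻ ω, F (frestrictLe (π := fun _ : ℕ => V) n ω) * stepMean G f (ω n) ∂(walkLaw G u) := by
  have hf : Measurable f := measurable_of_finite f
  have hg : Measurable (stepMean G f) := measurable_of_finite _
  have hF : Measurable F := measurable_of_finite F
  have h := Kernel.map_frestrictLe_trajMeasure_compProd_eq_map_trajMeasure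
    (X := fun _ : ℕ => V) (μ₀ := Measure.dirac u) (κ := historyKernel G) (a := n)
  have h' := congrArg (fun μ => ∫⁻ p, F p.1 * f p.2 ∂μ) h
  rw [lintegral_map (by fun_prop) (by fun_prop), Measure.lintegral_compProd (by fun_prop)] at h'
  rw [walkLaw, ← h']
  have h3 : ∀ z : Finset.Iic n → V, ∫⁻ y, F z * f y ∂(historyKernel G n z) =
      F z * stepMean G f (z ⟨n, Finset.mem_Iic.2 le_rfl⟩) := fun z => by
    rw [lintegral_const_mul _ hf]; rfl
  simp only [h3]
  rw [lintegral_map (by fun_prop) (by fun_prop)]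
  rfl

-- Markov property at the last step: integrating out the final position turns f into `killedMean G v
-- f`, so the induction must run over all f.
open Classical in
theorem lintegral_walkLaw_avoid (v : V) (n : ℕ) : ∀ (f : V → ℝ≥0∞) (u : V),
    ∫⁻ ω, (if ∀ k ≤ n, ω k ≠ v then f (ω n) else 0) ∂(walkLaw G u) =
      ({v}ᶜ : Set V).indicator ((killedMean G v)^[n] f) u := by
  induction n with
  | zero =>
    intro f u
    have := lintegral_walkLaw_zero G u (({v}ᶜ : Set V).indicator f)
    rw [Function.iterate_zero_apply, ← this]
    congr with ω
    simp [Set.indicator]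
  | succ n ih =>
    intro f u
    rw [Function.iterate_succ_apply, ← ih]
    have := lintegral_walkLaw_succ G u n
      (fun z => if ∀ k : Finset.Iic n, z k ≠ v then 1 else 0) (({v}ᶜ : Set V).indicator f)
    convert this using 2 with ω
    · ext ω
      simp only [frestrictLe_apply, Subtype.forall, Finset.mem_Iic, Set.indicator,
        Nat.le_succ_iff_eq_or_le, forall_eq_or_imp]
      by_cases h1 : ω (n + 1) = v <;> by_cases h2 : ∀ k ≤ n, ω k ≠ v <;> simp [h1, h2]
    · ext ω
      simp only [frestrictLe_apply, Subtype.forall, Finset.mem_Iic]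
      by_cases h2 : ∀ k ≤ n, ω k ≠ v <;> simp [h2, killedMean]

end Law

open Classical in
theorem firstHit_eq_tsum {V : Type*} (v : V) (ω : ℕ → V) :
    (firstHit v ω : ℝ≥0∞) = ∑' n : ℕ, if ∀ k ≤ n, ω k ≠ v then 1 else 0 := by
  have key : ∀ n : ℕ, (∀ k ≤ n, ω k ≠ v) ↔ (n : ℕ∞) < firstHit v ω := by
    intro n
    rw [← not_le, firstHit]
    erw [hittingAfter_le_iff]
    simp
  simp only [key]
  cases h : firstHit v ω using ENat.recTopCoe with
  | top => simp
  | coe m =>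
    rw [tsum_eq_sum (s := Finset.range m) (by simp)]
    simp only [Nat.cast_lt]
    rw [Finset.sum_congr rfl (g := fun _ => 1)]
    · simp
    · simp

/-! ### Equations and bounds for hitting times -/

section Hitting

variable {V : Type*} [Fintype V] [MeasurableSpace V] [DiscreteMeasurableSpace V]
  (G : SimpleGraph V) [DecidableRel G.Adj]

theorem stepMean_eq_sum (f : V → ℝ≥0∞) {x : V} (hx : (G.neighborFinset x).Nonempty) :
    stepMean G f x = (∑ y ∈ G.neighborFinset x, f y) / G.degree x := by
  classical
  have : stepKernel G x = (PMF.uniformOfFinset (G.neighborFinset x) hx).toMeasure := by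
    change (stepLaw G x).toMeasure = _
    rw [stepLaw, dif_pos hx]
  rw [stepMean, this, lintegral_fintype]
  simp only [PMF.toMeasure_apply_singleton _ _ (MeasurableSet.singleton _),
    PMF.uniformOfFinset_apply]
  rw [ENNReal.div_eq_inv_mul, Finset.mul_sum]
  simp [mul_comm, Finset.sum_ite, ← SimpleGraph.neighborFinset_eq_filter]

theorem stepMean_const_le (c : ℝ≥0∞) (x : V) : stepMean G (fun _ => c) x ≤ c := by
  simp [stepMean]

theorem stepMean_mono {f g : V → ℝ≥0∞} (h : ∀ x, f x ≤ g x) (x : V) :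
    stepMean G f x ≤ stepMean G g x := lintegral_mono h

theorem stepMean_add (f g : V → ℝ≥0∞) (x : V) :
    stepMean G (fun y => f y + g y) x = stepMean G f x + stepMean G g x :=
  lintegral_add_left (measurable_of_finite f) g

/-- The probability that the walk started at `u` avoids `v` up to time `n`. -/
noncomputable def avoidProb (v : V) (n : ℕ) (u : V) : ℝ≥0∞ :=
  ({v}ᶜ : Set V).indicator ((killedMean G v)^[n] 1) u

theorem avoidProb_self (v : V) (n : ℕ) : avoidProb G v n v = 0 := by simp [avoidProb]

theorem avoidProb_zero {u v : V} (h : u ≠ v) : avoidProb G v 0 u = 1 := by simp [avoidProb, h]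

theorem avoidProb_succ {u v : V} (h : u ≠ v) (n : ℕ) :
    avoidProb G v (n + 1) u = stepMean G (avoidProb G v n) u := by
  simp only [avoidProb, Function.iterate_succ_apply']
  rw [Set.indicator_of_mem (by simpa using h)]
  rfl

theorem expectedHit_eq_tsum (u v : V) : expectedHit G u v = ∑' n, avoidProb G v n u := by
  classical
  simp only [expectedHit, firstHit_eq_tsum]
  rw [lintegral_tsum]
  · congr with n
    exact lintegral_walkLaw_avoid G v n 1 u
  · intro n
    refine (Measurable.ite ?_ measurable_const measurable_const).aemeasurable
    have : {ω : ℕ → V | ∀ k ≤ n, ω k ≠ v} = ⋂ k ≤ n, (fun ω : ℕ → V => ω k) ⁻¹' {v}ᶜ := by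
      ext; simp
    rw [this]
    exact MeasurableSet.biInter (Set.to_countable _) fun k _ =>
      (measurable_pi_apply k) (MeasurableSet.of_discrete)

theorem expectedHit_eq_one_add {u v : V} (h : u ≠ v) :
    expectedHit G u v = 1 + stepMean G (fun y => expectedHit G y v) u := by
  simp only [expectedHit_eq_tsum, stepMean]
  rw [lintegral_tsum fun n => (measurable_of_finite _).aemeasurable,
    tsum_eq_zero_add' ENNReal.summable, avoidProb_zero G h]
  simp only [avoidProb_succ G h, stepMean]

/-- A bounded function that is strictly subharmonic away from `v` bounds the hitting times. -/
theorem expectedHit_add_le {v : V} {w : V → ℝ≥0∞} {C : ℝ≥0∞} (hC : ∀ x, w x ≤ C)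
    (hw : ∀ x, x ≠ v → 1 + w x ≤ stepMean G w x) (u : V) : expectedHit G u v + w u ≤ C := by
  -- Partial sums are expected hitting times truncated at N; first-step analysis gives the induction
  -- without presupposing finiteness.
  have key : ∀ N u, (∑ n ∈ Finset.range N, avoidProb G v n u) + w u ≤ C := by
    intro N
    induction N with
    | zero => simpa using hC
    | succ N ih =>
      intro u
      by_cases hu : u = v
      · subst hu; simpa [avoidProb_self] using hC u
      · have hs : ∑ n ∈ Finset.range N, stepMean G (avoidProb G v n) u =
            stepMean G (fun y => ∑ n ∈ Finset.range N, avoidProb G v n y) u :=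
          (lintegral_finsetSum _ fun n _ => measurable_of_finite _).symm
        rw [Finset.sum_range_succ']
        simp only [avoidProb_succ G hu, avoidProb_zero G hu]
        rw [add_assoc, hs]
        calc _ ≤ _ + stepMean G w u := by gcongr; exact hw u hu
          _ = _ := (stepMean_add G _ _ u).symm
          _ ≤ stepMean G (fun _ => C) u := stepMean_mono G ih u
          _ ≤ C := stepMean_const_le G C u
  rw [expectedHit_eq_tsum, ENNReal.tsum_eq_iSup_nat, ENNReal.iSup_add]
  exact iSup_le fun N => key N u

end Hitting

/-! ### Graph distance and sums over darts -/

theorem exists_adj_dist_add_one {V : Type*} {G : SimpleGraph V} (hG : G.Connected) {x v : V}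
    (h : x ≠ v) : ∃ y, G.Adj x y ∧ G.dist y v + 1 = G.dist x v := by
  obtain ⟨p, hp⟩ := hG.exists_walk_length_eq_dist x v
  cases p with
  | nil => exact absurd rfl h
  | @cons _ y _ hxy q =>
    refine ⟨y, hxy, le_antisymm ?_ ?_⟩
    · rw [← hp, SimpleGraph.Walk.length_cons]
      gcongr
      exact SimpleGraph.dist_le q
    · have := hG.dist_triangle (u := x) (v := y) (w := v)
      rw [SimpleGraph.dist_eq_one_iff_adj.2 hxy] at this
      omega

theorem abs_dist_sub_dist_le_one {V : Type*} {G : SimpleGraph V} (hG : G.Connected) {x y : V}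
    (h : G.Adj x y) (v : V) : |(G.dist x v : ℝ) - G.dist y v| ≤ 1 := by
  have h1 := hG.dist_triangle (u := x) (v := y) (w := v)
  have h2 := hG.dist_triangle (u := y) (v := x) (w := v)
  rw [SimpleGraph.dist_eq_one_iff_adj.2 h] at h1
  rw [SimpleGraph.dist_eq_one_iff_adj.2 h.symm] at h2
  rw [abs_le]
  constructor <;> rw [← Nat.cast_le (α := ℝ)] at h1 h2 <;> push_cast at h1 h2 <;> linarith

theorem sum_dart_eq_sum_neighborFinset {V : Type*} [Fintype V] (G : SimpleGraph V)
    [DecidableRel G.Adj] (F : V → V → ℝ) :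
    ∑ e : G.Dart, F e.fst e.snd = ∑ x, ∑ y ∈ G.neighborFinset x, F x y := by
  rw [Finset.sum_sigma']
  refine Finset.sum_bij' (fun e _ => ⟨e.fst, e.snd⟩)
    (fun p hp => ⟨(p.1, p.2), by simpa using hp⟩) ?_ ?_ ?_ ?_ ?_ <;> simp

theorem sum_dart_swap {V : Type*} [Fintype V] (G : SimpleGraph V)
    [DecidableRel G.Adj] (F : V → V → ℝ) :
    ∑ e : G.Dart, F e.snd e.fst = ∑ e : G.Dart, F e.fst e.snd :=
  Equiv.sum_comp (SimpleGraph.Dart.symm_involutive (G := G)).toPerm fun e => F e.fst e.snd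

/-! ### Finiteness and the lower bound -/

section

variable {V : Type*} [Fintype V] [MeasurableSpace V] [DiscreteMeasurableSpace V]
  {G : SimpleGraph V} [DecidableRel G.Adj]

theorem expectedHit_ne_top (hG : G.Connected) (u v : V) : expectedHit G u v ≠ ⊤ := by
  set R := Finset.univ.sup fun x => G.dist x v
  have hdR : ∀ x, G.dist x v ≤ R := fun x =>
    Finset.le_sup (f := fun x => G.dist x v) (Finset.mem_univ x)
  -- With this M, a single neighbour closer to v contributes M^(k+1)/deg x ≥ 2 M^k ≥ 1 + M^k to the
  -- mean, where M^k = w x.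
  set M : ℕ := 2 * Fintype.card V with hM
  have hV : 0 < Fintype.card V := Fintype.card_pos_iff.2 ⟨u⟩
  have hM1 : 1 ≤ M := by omega
  let w : V → ℝ≥0∞ := fun x => ((M ^ (R - G.dist x v) : ℕ) : ℝ≥0∞)
  have hC : ∀ x, w x ≤ ((M ^ R : ℕ) : ℝ≥0∞) := fun x =>
    Nat.cast_le.2 (Nat.pow_le_pow_right hM1 (Nat.sub_le _ _))
  have hw : ∀ x, x ≠ v → 1 + w x ≤ stepMean G w x := by
    intro x hx
    obtain ⟨y, hxy, hy⟩ := exists_adj_dist_add_one hG hx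
    have hmem : y ∈ G.neighborFinset x := by simpa using hxy
    have hdeg : G.degree x ≤ Fintype.card V := (G.degree_lt_card_verts x).le
    have hdeg0 : G.degree x ≠ 0 := (Finset.card_pos.2 ⟨y, hmem⟩).ne'
    rw [stepMean_eq_sum G w ⟨y, hmem⟩, ENNReal.le_div_iff_mul_le (by simp [hdeg0]) (by simp)]
    refine le_trans ?_ (Finset.single_le_sum (fun _ _ => zero_le) hmem)
    have hexp : R - G.dist y v = R - G.dist x v + 1 := by have := hdR x; omega
    have hpos : 1 ≤ M ^ (R - G.dist x v) := Nat.one_le_pow _ _ hM1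
    simp only [w, hexp]
    norm_cast
    calc (1 + M ^ (R - G.dist x v)) * G.degree x
        ≤ (2 * M ^ (R - G.dist x v)) * Fintype.card V := Nat.mul_le_mul (by omega) hdeg
      _ = M ^ (R - G.dist x v + 1) := by rw [pow_succ, hM]; ring
  have := expectedHit_add_le G hC hw u
  exact ne_top_of_le_ne_top (ENNReal.natCast_ne_top _) (le_self_add.trans this)

theorem sum_H_sub_eq_degree (hG : G.Connected) {x v : V} (h : x ≠ v) :
    ∑ y ∈ G.neighborFinset x, (H G x v - H G y v) = G.degree x := by
  obtain ⟨y, hxy, -⟩ := exists_adj_dist_add_one hG h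
  have hne : (G.neighborFinset x).Nonempty := ⟨y, by simpa using hxy⟩
  have hdeg : (G.degree x : ℝ) ≠ 0 := by exact_mod_cast (Finset.card_pos.2 hne).ne'
  have h1 := expectedHit_eq_one_add G h
  rw [stepMean_eq_sum G _ hne] at h1
  have hs : ∑ y ∈ G.neighborFinset x, expectedHit G y v ≠ ⊤ :=
    ENNReal.sum_ne_top.2 fun y _ => expectedHit_ne_top hG y v
  have h2 : H G x v = 1 + (∑ y ∈ G.neighborFinset x, H G y v) / G.degree x := by
    rw [H, h1, ENNReal.toReal_add (by simp)
      (ENNReal.div_ne_top hs (by exact_mod_cast hdeg)), ENNReal.toReal_div,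
      ENNReal.toReal_sum fun y _ => expectedHit_ne_top hG y v]
    simp [H]
  rw [Finset.sum_sub_distrib, Finset.sum_const, SimpleGraph.card_neighborFinset_eq_degree,
    nsmul_eq_mul, h2]
  field_simp
  ring

/-- Summation by parts: pairing each dart with its reverse makes the test function appear as a
difference along edges, and the contribution of the −1 cancels. -/
theorem two_mul_sum_degree_mul_dist_le (hG : G.Connected) (v : V) :
    2 * ∑ x, (G.degree x : ℝ) * G.dist x v ≤
      ∑ e : G.Dart, |H G e.fst v - H G e.snd v - 1| := by
  have hlap : ∑ e : G.Dart, (G.dist e.fst v : ℝ) * (H G e.fst v - H G e.snd v) =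
      ∑ x, (G.degree x : ℝ) * G.dist x v := by
    rw [sum_dart_eq_sum_neighborFinset G fun x y => (G.dist x v : ℝ) * (H G x v - H G y v)]
    refine Finset.sum_congr rfl fun x _ => ?_
    rw [← Finset.mul_sum]
    -- The equation for H is unavailable at v, but there the weight is 0.
    by_cases hx : x = v
    · simp [hx]
    · rw [sum_H_sub_eq_degree hG hx, mul_comm]
  have hlap' := sum_dart_swap G fun x y => (G.dist x v : ℝ) * (H G x v - H G y v)
  have hd := sum_dart_swap G fun x _ => (G.dist x v : ℝ)
  calc _ = ∑ e : G.Dart, ((G.dist e.fst v : ℝ) - G.dist e.snd v) *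
        (H G e.fst v - H G e.snd v - 1) := by
        have : ∀ e : G.Dart, ((G.dist e.fst v : ℝ) - G.dist e.snd v) *
            (H G e.fst v - H G e.snd v - 1) =
            (G.dist e.fst v : ℝ) * (H G e.fst v - H G e.snd v) +
            (G.dist e.snd v : ℝ) * (H G e.snd v - H G e.fst v) -
            ((G.dist e.fst v : ℝ) - G.dist e.snd v) := fun e => by ring
        simp only [this, Finset.sum_sub_distrib, Finset.sum_add_distrib, hlap', hd, hlap]
        ring
    _ ≤ _ := by
        refine Finset.sum_le_sum fun e _ => (le_abs_self _).trans ?_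
        rw [abs_mul]
        exact mul_le_of_le_one_left (abs_nonneg _) (abs_dist_sub_dist_le_one hG e.adj v)

theorem card_dart_add_sum_degree_mul_dist_le_K (hG : G.Connected) (v : V) :
    (Fintype.card G.Dart : ℝ) / 2 + ∑ x, (G.degree x : ℝ) * G.dist x v ≤ K G := by
  -- The starting point is irrelevant: only H ≥ 0 is used, so the pair (v, v) suffices.
  have hle := le_ciSup (f := fun p : V × V => (H G p.1 p.2 + 1 / 2 * ((Fintype.card G.Dart : ℝ) +
    ∑ e : G.Dart, |H G e.fst p.2 - H G e.snd p.2 - 1|))) (Set.finite_range _).bddAbove (v, v)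
  have hH : 0 ≤ H G v v := ENNReal.toReal_nonneg
  have := two_mul_sum_degree_mul_dist_le hG v
  refine le_trans ?_ hle
  simp only
  linarith

theorem half_diam_mul_card_dart_le_K (hG : G.Connected) :
    1 / 2 * (G.diam : ℝ) * (Fintype.card G.Dart : ℝ) + (Fintype.card G.Dart : ℝ) / 2 ≤ K G := by
  have := hG.nonempty
  obtain ⟨a, b, hab⟩ := G.exists_dist_eq_diam
  have ha := card_dart_add_sum_degree_mul_dist_le_K hG a
  have hb := card_dart_add_sum_degree_mul_dist_le_K hG b
  have hsum : (G.diam : ℝ) * (Fintype.card G.Dart : ℝ) ≤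
      ∑ x, (G.degree x : ℝ) * G.dist x a + ∑ x, (G.degree x : ℝ) * G.dist x b := by
    rw [G.dart_card_eq_sum_degrees, Nat.cast_sum, Finset.mul_sum, ← Finset.sum_add_distrib]
    refine Finset.sum_le_sum fun x _ => ?_
    rw [← mul_add, mul_comm]
    refine mul_le_mul_of_nonneg_left ?_ (Nat.cast_nonneg _)
    rw [← hab, G.dist_comm (u := x) (v := a)]
    exact_mod_cast hG.dist_triangle
  linarith

end

end RandomWalk

theorem corollaryc {V : Type*} [Fintype V] [MeasurableSpace V] [DiscreteMeasurableSpace V]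
    (G : SimpleGraph V) [DecidableRel G.Adj] (hG : G.Connected) :
    (∀ u v : V, RandomWalk.expectedHit G u v ≠ ⊤) ∧
      RandomWalk.K G ≥ 1 / 4 * (G.diam : ℝ) * (Fintype.card G.Dart : ℝ) - 1 := by
  refine ⟨RandomWalk.expectedHit_ne_top hG, ?_⟩
  have h := RandomWalk.half_diam_mul_card_dart_le_K hG
  have h1 : 0 ≤ (G.diam : ℝ) * (Fintype.card G.Dart : ℝ) := by positivity
  have h2 : 0 ≤ (Fintype.card G.Dart : ℝ) := by positivity
  linarith
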